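/- **Game.** For $i\in\{1,\dots,N\}$ let $V_i$ be a finite-dimensional real normed space (e.g. $\mathbb R^{n_i}$ with an arbitrary norm), let $\mathcal X_i\subseteq V_i$ be nonempty, closed, convex and bounded, and put $\mathcal X=\prod_i\mathcal X_i$. Player $i$ minimizes over $x^i\in\mathcal X_i$ an objective $J_i(x^i;x^{-i})$ that is continuously differentiable on $\mathcal X$. (Gradients are elements of dual spaces; derivatives are taken relative to the sets on which the functions are given, and where such a gradient is not unique any choice is allowed.) The game has a potential $\Phi:\mathcal X\to\mathbb R$, i.e. $J_i(x^i;x^{-i})-J_i(u^i;x^{-i})=\Phi(x^i,x^{-i})-\Phi(u^i,x^{-i})$ for all $i$, all $x^i,u^i\in\mathcal X_i$ and all $x^{-i}$, and $\Phi$ is convex and $L$-smooth: for some norm $\|\cdot\|$ on $\prod_i V_i$ with dual norm $\|\cdot\|_*$, $\|\nabla\Phi(x)-\nabla\Phi(x')\|_*\le L\|x-x'\|$ on $\mathcal X$. Each player has a continuous $\mu_i$-strongly convex regularizer $\psi_i:\mathcal X_i\to\mathbb R$ ($\mu_i>0$), differentiable at the initial point $x_0^i$ below (in particular, any differentiable one),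 with mirror map $\nabla\psi_i^*(z)=\operatorname{argmax}_{u\in\mathcal X_i}\{\langle z,u\rangle-\psi_i(u)\}$. **Delays.** The feedback $g^i_k=\nabla_iJ_i(x_k^i;x_k^{-i})$ generated at stage $k\ge1$ has a delay $d^i_k$ with $0\le d^i_k\le D\,k$, for some constant $D>0$. **Algorithm.** Let $a_k=a_0/k$ for some $a_0>0$, and $A_k=\sum_{t=1}^k a_t$, $A_0=0$. Initialize $x_0=x_1\in\mathcal X$, $z^i_0=\nabla\psi_i(x^i_0)$, $y_0=0$, $s^i(0)=1$. For $k\ge1$ and every player $i$: let $\mathcal R^i_k=\{t\ge1: k-1<t+d^i_t\le k\}$ and $s^i(k)=\max(\{s^i(k-1)\}\cup\mathcal R^i_k)$, and set $$z^i_k=z^i_{k-1}-a_k\,g^i_{s^i(k)},\qquad y^i_k=\tfrac{A_{k-1}}{A_k}y^i_{k-1}+\tfrac{a_k}{A_k}\nabla\psi_i^*(z^i_k),\qquad x^i_{k+1}=\tfrac{A_k}{A_{k+1}}y^i_k+\tfrac{a_{k+1}}{A_{k+1}}\nabla\psi_i^*(z^i_k).$$ **Claim.** For every minimizer $x_*$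 of $\Phi$ over $\mathcal X$, $$\Phi(y_k)-\Phi(x_*)=O\!\left(\frac{\log\log k}{\log k}\right)\qquad(k\to\infty).$$ -/

import Mathlib

open Filter Asymptotics

/-- The strategy space `∏ i, X i` of the whole game. -/
def jointSpace {ι : Type*} {V : ι → Type*} (X : ∀ i, Set (V i)) : Set (∀ i, V i) :=
  Set.univ.pi X

/-- `Φ` is a potential function of the game with objectives `J` and strategy spaces `X`:
a unilateral change of player `i` from `x i` to `u` changes `J i` and `Φ` by the same amount. -/
def IsPotential {ι : Type*} [DecidableEq ι] {V : ι → Type*} (X : ∀ i, Set (V i))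
    (J : ι → (∀ i, V i) → ℝ) (Φ : (∀ i, V i) → ℝ) : Prop :=
  ∀ i, ∀ x ∈ jointSpace X, ∀ u ∈ X i,
    J i (Function.update x i u) - J i x = Φ (Function.update x i u) - Φ x

/-- `G i x` is a partial gradient `∇_i J_i (x^i; x^{-i})` at every action profile `x`. Gradients are
linear functionals on `V i`. Since `J i` only has to be given on the strategy space, the derivative
is taken within `X i`; it is the usual one at interior points, and if `X i` has empty interior
every choice of it (such as the gradient of a smooth extension of `J i`) is allowed. -/
def IsPartialGradient {ι : Type*} [DecidableEq ι] {V : ι → Type*}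
    [∀ i, NormedAddCommGroup (V i)] [∀ i, NormedSpace ℝ (V i)] (X : ∀ i, Set (V i))
    (J : ι → (∀ i, V i) → ℝ) (G : ∀ i, (∀ j, V j) → StrongDual ℝ (V i)) : Prop :=
  ∀ i, ∀ x ∈ jointSpace X,
    HasFDerivWithinAt (fun u => J i (Function.update x i u)) (G i x) (X i) (x i)

/-- `f` is `L`-smooth on `S` with respect to the norm `p`: it has a gradient at every point of `S`
and `‖∇f(x) - ∇f(y)‖_* ≤ L ‖x - y‖`, where `‖·‖_*` is the dual norm of `p`. -/
def IsSmoothOn {E : Type*} [NormedAddCommGroup E] [NormedSpace ℝ E] (p : Seminorm ℝ E) (L : ℝ)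
    (S : Set E) (f : E → ℝ) : Prop :=
  ∃ f' : E → StrongDual ℝ E, (∀ x ∈ S, HasFDerivWithinAt f (f' x) S x) ∧
    ∀ x ∈ S, ∀ y ∈ S, ∀ w, |(f' x - f' y) w| ≤ L * p (x - y) * p w

/-- The mirror map `∇ψ^*(z) = argmax_{u ∈ X} {⟨z, u⟩ - ψ(u)}`. -/
noncomputable def mirrorMap {E : Type*} [NormedAddCommGroup E] [NormedSpace ℝ E] (X : Set E)
    (ψ : E → ℝ) (z : StrongDual ℝ E) : E :=
  Classical.epsilon fun v => v ∈ X ∧ IsMaxOn (fun u => z u - ψ u) X v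

/-- `A_k = ∑_{t=1}^k a_t`. -/
noncomputable def stepSum (a : ℕ → ℝ) (k : ℕ) : ℝ :=
  ∑ t ∈ Finset.Icc 1 k, a t

/-- The stages `t ≥ 1` whose feedback, delayed by `d t ≥ 0`, arrives at iteration `k`, i.e.
`k - 1 < t + d t ≤ k`; such a `t` is at most `k`. -/
noncomputable def arrivals (d : ℕ → ℝ) (k : ℕ) : Finset ℕ :=
  {t ∈ Finset.Icc 1 k | (k : ℝ) - 1 < t + d t ∧ t + d t ≤ k}

/-- `s(k)`: the stage from which the feedback used at iteration `k` originates. It starts at `1` and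
is replaced by the most recent stage among the arrivals whenever that is more recent. -/
noncomputable def usedStage (d : ℕ → ℝ) : ℕ → ℕ
  | 0 => 1
  | k + 1 => max (usedStage d k) ((arrivals d (k + 1)).sup id)

/-- The sequences `x`, `y`, `z` are generated by the Nash equilibrium seeking algorithm with delayed
feedback, for strategy spaces `X`, regularizers `ψ`, partial gradients `G`, step sizes `a`
and delays `d`. -/
structure IsDelayedRun {ι : Type*} {V : ι → Type*}
    [∀ i, NormedAddCommGroup (V i)] [∀ i, NormedSpace ℝ (V i)] (X : ∀ i, Set (V i))
    (ψ : ∀ i, V i → ℝ) (G : ∀ i, (∀ j, V j) → StrongDual ℝ (V i)) (a : ℕ → ℝ) (d : ι → ℕ → ℝ)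
    (x y : ℕ → ∀ i, V i) (z : ℕ → ∀ i, StrongDual ℝ (V i)) : Prop where
  x_zero_mem : x 0 ∈ jointSpace X
  x_one : x 1 = x 0
  /-- `z_0 = ∇ψ(x_0)` -/
  z_zero : ∀ i, HasFDerivWithinAt (ψ i) (z 0 i) (X i) (x 0 i)
  y_zero : y 0 = 0
  z_step : ∀ k i, z (k + 1) i = z k i - a (k + 1) • G i (x (usedStage (d i) (k + 1)))
  y_step : ∀ k i, y (k + 1) i = (stepSum a k / stepSum a (k + 1)) • y k i +
    (a (k + 1) / stepSum a (k + 1)) • mirrorMap (X i) (ψ i) (z (k + 1) i)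
  x_step : ∀ k i, x (k + 2) i = (stepSum a (k + 1) / stepSum a (k + 2)) • y (k + 1) i +
    (a (k + 2) / stepSum a (k + 2)) • mirrorMap (X i) (ψ i) (z (k + 1) i)

/-! Track the weighted gap `A_k (Φ(y_k) - Φ(x_*))`. Convexity and smoothness
(`ConvexOn.averaging_step`) bound its increment by `a_k ⟨∇Φ(x_k), v_k - x_*⟩` plus `A_k |L| ‖y_k -
x_k‖²`, where `v_k` is the mirror point of `z_k`.

Replace `∇Φ(x_k)` by the delayed partial gradients that drive `z_k`. Since `v_k` already
incorporates the gradient it is tested against, the resulting sum is a look-ahead regret, bounded by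
a constant whatever the delays (`mirrorMap_regret`).

Two errors remain. As `x_k` and `y_k` differ only in a point of weight `a_k/A_k`, the smoothness
error is `O(a_k²/A_k)`. Linear delays make the stage in use at least proportional to `k`; the
iterates move by `O(a_t/A_t)` per stage, and `∑ a_t` over a window of bounded ratio is bounded, so
the delayed point is `O(1/A_k)` away and costs `O(a_k/A_k)`. Summing, `∑ a_k/A_k` grows like `log
A_n`, i.e. `log log n`; division by `A_n ≥ a₀ log n` gives the rate. -/

/-! ### Convex smooth functions with one-sided gradients -/

section Gradients

variable {E : Type*} [NormedAddCommGroup E] [NormedSpace ℝ E] {S : Set E} {f : E → ℝ}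

theorem HasFDerivWithinAt.hasDerivWithinAt_segment {f' : StrongDual ℝ E} {x y : E}
    (hS : Convex ℝ S) (h : HasFDerivWithinAt f f' S x) (hx : x ∈ S) (hy : y ∈ S) :
    HasDerivWithinAt (fun t : ℝ => f (x + t • (y - x))) (f' (y - x)) (Set.Icc 0 1) 0 := by
  have hl : HasDerivWithinAt (fun t : ℝ => x + t • (y - x)) (y - x) (Set.Icc 0 1) 0 := by
    have := ((hasDerivAt_id (0 : ℝ)).smul_const (y - x)).const_add x
    simpa using this.hasDerivWithinAt
  have h' : HasFDerivWithinAt f f' S (x + (0 : ℝ) • (y - x)) := by simpa using h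
  exact h'.comp_hasDerivWithinAt (0 : ℝ) hl fun t ht => hS.add_smul_sub_mem hx hy ht

theorem ConvexOn.gradient_le_sub {f' : StrongDual ℝ E} {x y : E} (hf : ConvexOn ℝ S f)
    (h : HasFDerivWithinAt f f' S x) (hx : x ∈ S) (hy : y ∈ S) :
    f' (y - x) ≤ f y - f x := by
  have hd := h.hasDerivWithinAt_segment hf.1 hx hy
  have hc : ConvexOn ℝ (Set.Icc (0 : ℝ) 1) (fun t : ℝ => f (x + t • (y - x))) := by
    refine ⟨convex_Icc 0 1, fun s hs t ht a b ha hb hab => ?_⟩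
    have := hf.2 (hf.1.add_smul_sub_mem hx hy hs) (hf.1.add_smul_sub_mem hx hy ht) ha hb hab
    convert this using 2
    rw [smul_add, smul_add, add_add_add_comm, ← add_smul, hab, one_smul, smul_smul, smul_smul,
      ← add_smul]
    rfl
  have := hc.le_slope_of_hasDerivWithinAt (x := 0) (y := 1) (by simp) (by simp) one_pos hd
  simpa [slope_def_field] using this

/-- The gradient inequality at `y`, with `f' y` exchanged for `f' x`. This gives the constant `L`
instead of `L / 2`, but needs no integration along the segment. -/
theorem ConvexOn.sub_le_gradient_add {f' : E → StrongDual ℝ E} {p : Seminorm ℝ E} {L : ℝ} {x y : E}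
    (hf : ConvexOn ℝ S f) (hd : ∀ x ∈ S, HasFDerivWithinAt f (f' x) S x)
    (hL : ∀ x ∈ S, ∀ y ∈ S, ∀ w, |(f' x - f' y) w| ≤ L * p (x - y) * p w)
    (hx : x ∈ S) (hy : y ∈ S) :
    f y - f x ≤ f' x (y - x) + L * p (y - x) ^ 2 := by
  have h1 := hf.gradient_le_sub (hd y hy) hy hx
  have h2 := (le_abs_self _).trans (hL y hy x hx (y - x))
  have h3 : f' y (x - y) = - f' y (y - x) := by rw [← map_neg, neg_sub]
  rw [sub_apply] at h2
  nlinarith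

/-- One step of the averaging scheme `B y = A y₀ + a v` for a convex smooth function. -/
theorem ConvexOn.averaging_step {f' : E → StrongDual ℝ E} {p : Seminorm ℝ E} {L : ℝ}
    {x y y₀ v u : E} {A a B : ℝ}
    (hf : ConvexOn ℝ S f) (hd : ∀ x ∈ S, HasFDerivWithinAt f (f' x) S x)
    (hL : ∀ x ∈ S, ∀ y ∈ S, ∀ w, |(f' x - f' y) w| ≤ L * p (x - y) * p w)
    (hx : x ∈ S) (hy : y ∈ S) (hu : u ∈ S) (hA : 0 ≤ A) (ha : 0 ≤ a) (hy₀ : A = 0 ∨ y₀ ∈ S)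
    (hB : B = A + a) (hyB : B • y = A • y₀ + a • v) :
    B * f y - A * f y₀ - a * f u ≤ a * f' x (v - u) + B * (L * p (y - x) ^ 2) := by
  have h1 := mul_le_mul_of_nonneg_left (hf.sub_le_gradient_add hd hL hx hy) (by linarith : 0 ≤ B)
  -- The initial average may lie outside `S`, but then its weight is zero.
  have h2 : A * f' x (y₀ - x) ≤ A * (f y₀ - f x) := by
    rcases hy₀ with rfl | h
    · simp
    · exact mul_le_mul_of_nonneg_left (hf.gradient_le_sub (hd x hx) hx h) hA
  have h3 := mul_le_mul_of_nonneg_left (hf.gradient_le_sub (hd x hx) hx hu) ha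
  have h4 : B * f' x y = A * f' x y₀ + a * f' x v := by
    simpa using congrArg (f' x) hyB
  simp only [map_sub] at *
  subst hB
  linarith

end Gradients

/-! ### Mirror map and look-ahead regret -/

section MirrorMap

variable {E : Type*} [NormedAddCommGroup E] [NormedSpace ℝ E] {X : Set E} {ψ : E → ℝ}

theorem mirrorMap_spec (hX : IsCompact X) (hne : X.Nonempty) (hψ : ContinuousOn ψ X)
    (z : StrongDual ℝ E) :
    mirrorMap X ψ z ∈ X ∧ IsMaxOn (fun u => z u - ψ u) X (mirrorMap X ψ z) := by
  have h : ContinuousOn (fun u => z u - ψ u) X := z.continuous.continuousOn.sub hψ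
  obtain ⟨v, hv⟩ := hX.exists_isMaxOn hne h
  exact Classical.epsilon_spec (p := fun v => v ∈ X ∧ IsMaxOn (fun u => z u - ψ u) X v) ⟨v, hv⟩

/-- The regret bound of the player who sees the current loss before acting. -/
theorem mirrorMap_regret (hX : IsCompact X) (hne : X.Nonempty) (hψ : ContinuousOn ψ X)
    {z g : ℕ → StrongDual ℝ E} {a : ℕ → ℝ} (hz : ∀ k, z (k + 1) = z k - a (k + 1) • g (k + 1))
    {u : E} (hu : u ∈ X) (n : ℕ) :
    ∑ k ∈ Finset.range n, a (k + 1) * g (k + 1) (mirrorMap X ψ (z (k + 1)) - u) ≤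
      (ψ u - z 0 u) - (ψ (mirrorMap X ψ (z 0)) - z 0 (mirrorMap X ψ (z 0))) := by
  -- Be-the-leader induction: the invariant keeps the optimal value at `z n`, and the step tests the
  -- optimality of the old mirror point against the new one.
  have key : ∀ n, ∑ k ∈ Finset.range n, a (k + 1) * g (k + 1) (mirrorMap X ψ (z (k + 1)) - u) ≤
      (ψ (mirrorMap X ψ (z n)) - z n (mirrorMap X ψ (z n))) + (z n u - z 0 u)
        - (ψ (mirrorMap X ψ (z 0)) - z 0 (mirrorMap X ψ (z 0))) := by
    intro n
    induction n with
    | zero => simp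
    | succ n ih =>
      have hm := (mirrorMap_spec hX hne hψ (z n)).2 (mirrorMap_spec hX hne hψ (z (n + 1))).1
      simp only [Set.mem_ofPred_eq] at hm
      rw [Finset.sum_range_succ, map_sub]
      set v := mirrorMap X ψ (z (n + 1))
      have e1 : ∀ w, z (n + 1) w = z n w - a (n + 1) * g (n + 1) w := by intro w; simp [hz]
      rw [e1 v, e1 u]
      linarith
  have hm := (mirrorMap_spec hX hne hψ (z n)).2 hu
  simp only [Set.mem_ofPred_eq] at hm
  linarith [key n]

end MirrorMap

/-! ### Freshness of the feedback in use -/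

section Delays

theorem one_le_usedStage (d : ℕ → ℝ) (k : ℕ) : 1 ≤ usedStage d k := by
  induction k with
  | zero => simp [usedStage]
  | succ k ih => exact ih.trans (le_max_left _ _)

theorem usedStage_mono (d : ℕ → ℝ) : Monotone (usedStage d) :=
  monotone_nat_of_le_succ fun _ => le_max_left _ _

theorem usedStage_le (d : ℕ → ℝ) {k : ℕ} (hk : 1 ≤ k) : usedStage d k ≤ k := by
  have h : ∀ k, usedStage d k ≤ max 1 k := by
    intro k
    induction k with
    | zero => simp [usedStage]
    | succ k ih =>
      refine max_le (ih.trans (by omega)) (Finset.sup_le fun t ht => ?_)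
      have := (Finset.mem_Icc.1 (Finset.mem_filter.1 ht).1).2
      simp only [id]
      omega
  simpa [hk] using h k

/-- Stage `t` arrives exactly at iteration `⌈t + d t⌉`, and the stage in use never decreases. -/
theorem le_usedStage {d : ℕ → ℝ} {t k : ℕ} (ht : 1 ≤ t) (hd : 0 ≤ d t) (h : t + d t ≤ k) :
    t ≤ usedStage d k := by
  obtain ⟨m, hm⟩ : ∃ m, m = ⌈t + d t⌉₊ := ⟨_, rfl⟩
  have hmk : m ≤ k := hm ▸ Nat.ceil_le.2 h
  have h1 : (t : ℝ) + d t ≤ m := hm ▸ Nat.le_ceil _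
  have ht' : (1 : ℝ) ≤ t := by exact_mod_cast ht
  have h2 : (m : ℝ) < t + d t + 1 := hm ▸ Nat.ceil_lt_add_one (by linarith)
  have htm : t ≤ m := by exact_mod_cast (by linarith : (t : ℝ) ≤ m)
  refine le_trans ?_ (usedStage_mono d hmk)
  obtain ⟨j, rfl⟩ : ∃ j, m = j + 1 := ⟨m - 1, by omega⟩
  push_cast at h2
  refine le_max_of_le_right (Finset.le_sup (f := id) (b := t) ?_)
  rw [arrivals, Finset.mem_filter, Finset.mem_Icc]
  exact ⟨⟨ht, htm⟩, by push_cast; linarith, h1⟩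

/-- Stage `t = ⌊k / (1 + D)⌋`, if positive, has arrived by iteration `k`, because `t + d t ≤ (1 + D)
t ≤ k`. The factor 2 absorbs the rounding: `t + 1` is at most twice the stage in use, which is at
least 1. -/
theorem le_mul_usedStage {d : ℕ → ℝ} {D : ℝ} (hD : 0 < D)
    (hd : ∀ k : ℕ, 1 ≤ k → 0 ≤ d k ∧ d k ≤ D * k) (k : ℕ) :
    (k : ℝ) ≤ 2 * (1 + D) * usedStage d k := by
  have hs : (1 : ℝ) ≤ usedStage d k := by exact_mod_cast one_le_usedStage d k
  have hc : 0 < 1 + D := by linarith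
  set t := ⌊(k : ℝ) / (1 + D)⌋₊ with ht
  have h1 : (k : ℝ) / (1 + D) < t + 1 := Nat.lt_floor_add_one _
  rw [div_lt_iff₀ hc] at h1
  have h2 : (t : ℝ) ≤ usedStage d k := by
    rcases Nat.eq_zero_or_pos t with h0 | hpos
    · simp [h0]
    · have h3 : (t : ℝ) ≤ k / (1 + D) := Nat.floor_le (by positivity)
      rw [le_div_iff₀ hc] at h3
      exact_mod_cast le_usedStage hpos (hd t hpos).1 (by linarith [(hd t hpos).2])
  nlinarith

end Delays

/-! ### Harmonic step sizes and their sums -/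

section StepSizes

variable {a₀ : ℝ}

theorem stepSum_succ (a : ℕ → ℝ) (k : ℕ) : stepSum a (k + 1) = stepSum a k + a (k + 1) := by
  rw [stepSum, Finset.sum_Icc_succ_top (by omega)]
  rfl

@[simp] theorem stepSum_zero (a : ℕ → ℝ) : stepSum a 0 = 0 := by simp [stepSum]

theorem stepSum_const_div (a₀ : ℝ) (n : ℕ) :
    stepSum (fun k : ℕ => a₀ / k) n = a₀ * (harmonic n : ℝ) := by
  simp [stepSum, harmonic_eq_sum_Icc, Finset.mul_sum, div_eq_mul_inv]

theorem stepSum_const_div_mono (ha₀ : 0 < a₀) : Monotone (stepSum (fun k : ℕ => a₀ / k)) :=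
  monotone_nat_of_le_succ fun k => by
    rw [stepSum_succ]
    have : 0 < a₀ / ((k + 1 : ℕ) : ℝ) := by positivity
    linarith

theorem le_stepSum_const_div (ha₀ : 0 < a₀) {k : ℕ} (hk : 1 ≤ k) :
    a₀ ≤ stepSum (fun k : ℕ => a₀ / k) k := by
  have := stepSum_const_div_mono ha₀ hk
  simpa [stepSum] using this

theorem stepSum_const_div_sub_le (ha₀ : 0 < a₀) {s : ℕ} (hs : 1 ≤ s) (m : ℕ) :
    stepSum (fun k : ℕ => a₀ / k) (s + m) - stepSum (fun k : ℕ => a₀ / k) s ≤ m * (a₀ / s) := by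
  induction m with
  | zero => simp
  | succ m ih =>
    rw [← add_assoc, stepSum_succ]
    have h : a₀ / ((s + m + 1 : ℕ) : ℝ) ≤ a₀ / s := by
      have : (0 : ℝ) < s := by exact_mod_cast hs
      refine div_le_div_of_nonneg_left ha₀.le this ?_
      exact_mod_cast (by omega : s ≤ s + m + 1)
    push_cast at *
    linarith

/-- The increment from `s` to `k` is at most `(k - s) a₀ / s ≤ c a₀`, and `a₀` is the first term of
the sum up to `s`. -/
theorem stepSum_const_div_le_mul (ha₀ : 0 < a₀) {c : ℝ} {s k : ℕ} (hs : 1 ≤ s) (hsk : s ≤ k)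
    (hc : (k : ℝ) ≤ c * s) :
    stepSum (fun k : ℕ => a₀ / k) k ≤ (1 + c) * stepSum (fun k : ℕ => a₀ / k) s := by
  have hs' : (0 : ℝ) < s := by exact_mod_cast hs
  have hk' : (s : ℝ) ≤ k := by exact_mod_cast hsk
  have hc0 : 0 < c := by by_contra! h; nlinarith
  obtain ⟨m, rfl⟩ := Nat.exists_eq_add_of_le hsk
  have h1 := stepSum_const_div_sub_le ha₀ hs m
  have h2 := le_stepSum_const_div ha₀ hs
  have h3 : (m : ℝ) * (a₀ / s) ≤ c * a₀ := by
    rw [mul_div_assoc', div_le_iff₀ hs']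
    push_cast at hc
    nlinarith
  nlinarith

/-- Discrete form of `∫ dA / A = log A`: each term after the first is `1 - H_n / H_{n+1} ≤ log
(H_{n+1} / H_n)`, which telescopes. -/
theorem sum_div_stepSum_le (ha₀ : 0 < a₀) (n : ℕ) :
    ∑ k ∈ Finset.range (n + 1), a₀ / ((k + 1 : ℕ) : ℝ) / stepSum (fun k : ℕ => a₀ / k) (k + 1) ≤
      1 + Real.log (harmonic (n + 1)) := by
  have hpos : ∀ n : ℕ, (0 : ℝ) < harmonic (n + 1) := fun n => by
    exact_mod_cast harmonic_pos (by omega)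
  induction n with
  | zero =>
    simp [stepSum, harmonic, ha₀.ne']
  | succ n ih =>
    rw [Finset.sum_range_succ]
    have h1 := Real.one_sub_inv_le_log_of_pos (div_pos (hpos (n + 1)) (hpos n))
    rw [Real.log_div (hpos _).ne' (hpos _).ne', inv_div] at h1
    have h2 : a₀ / ((n + 1 + 1 : ℕ) : ℝ) / stepSum (fun k : ℕ => a₀ / k) (n + 1 + 1) =
        1 - (harmonic (n + 1) : ℝ) / harmonic (n + 1 + 1) := by
      have h3 : (harmonic (n + 1) : ℝ) = harmonic (n + 1 + 1) - ((n + 1 + 1 : ℕ) : ℝ)⁻¹ := by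
        rw [harmonic_succ (n + 1)]
        push_cast
        ring
      rw [stepSum_const_div, h3]
      have := (hpos (n + 1)).ne'
      have := ha₀.ne'
      field_simp
      ring
    linarith

theorem isBigO_loglog_div_log (ha₀ : 0 < a₀) {e : ℕ → ℝ} {K₀ K : ℝ} (hK : 0 ≤ K)
    (he : ∀ n, 1 ≤ n → 0 ≤ e n)
    (h : ∀ n, stepSum (fun k : ℕ => a₀ / k) (n + 1) * e (n + 1) ≤
      K₀ + K * ∑ k ∈ Finset.range (n + 1),
        a₀ / ((k + 1 : ℕ) : ℝ) / stepSum (fun k : ℕ => a₀ / k) (k + 1)) :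
    e =O[atTop] fun k : ℕ => Real.log (Real.log k) / Real.log k := by
  have hlog : Tendsto (fun k : ℕ => Real.log k) atTop atTop :=
    Real.tendsto_log_atTop.comp tendsto_natCast_atTop_atTop
  have hloglog := Real.tendsto_log_atTop.comp hlog
  refine IsBigO.of_bound ((|K₀| + K * 3) / a₀) ?_
  filter_upwards [hlog.eventually_ge_atTop 1, hloglog.eventually_ge_atTop 1, eventually_ge_atTop 1]
    with n h1 h2 hn
  simp only [Function.comp] at h2
  obtain ⟨m, rfl⟩ : ∃ m, n = m + 1 := ⟨n - 1, by omega⟩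
  set l := Real.log ((m + 1 : ℕ) : ℝ) with hl
  have hm1 : (0 : ℝ) < ((m + 1 : ℕ) : ℝ) := by positivity
  have hH : l ≤ harmonic (m + 1) := by
    refine le_trans (Real.log_le_log hm1 ?_) (log_add_one_le_harmonic (m + 1))
    push_cast
    linarith
  have hH' : (harmonic (m + 1) : ℝ) ≤ 2 * l := (harmonic_le_one_add_log (m + 1)).trans (by linarith)
  have hlogH : Real.log (harmonic (m + 1)) ≤ 1 + Real.log l := by
    refine (Real.log_le_log (by linarith) hH').trans ?_
    rw [Real.log_mul two_ne_zero (by linarith)]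
    linarith [Real.log_two_lt_d9]
  have hmain : a₀ * l * e (m + 1) ≤ (|K₀| + K * 3) * Real.log l := by
    calc a₀ * l * e (m + 1) ≤ a₀ * harmonic (m + 1) * e (m + 1) := by
          have := he (m + 1) hn
          gcongr
      _ ≤ K₀ + K * (1 + Real.log (harmonic (m + 1))) := by
          rw [← stepSum_const_div]
          exact (h m).trans (by gcongr; exact sum_div_stepSum_le ha₀ m)
      _ ≤ |K₀| * Real.log l + K * (3 * Real.log l) := by
          refine add_le_add ((le_abs_self _).trans ?_) ?_
          · exact le_mul_of_one_le_right (abs_nonneg _) h2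
          · gcongr
            linarith
      _ = _ := by ring
  rw [Real.norm_of_nonneg (he _ hn), Real.norm_of_nonneg (by positivity), div_mul_div_comm,
    le_div_iff₀ (by positivity)]
  linarith

end StepSizes

/-! ### Partial gradients versus the gradient of the potential -/

section Game

theorem update_mem_jointSpace {ι : Type*} {V : ι → Type*} {X : ∀ i, Set (V i)} [DecidableEq ι]
    {x : ∀ i, V i} (hx : x ∈ jointSpace X) {i : ι}
    {u : V i} (hu : u ∈ X i) : Function.update x i u ∈ jointSpace X := by
  intro j _
  rcases eq_or_ne j i with rfl | h
  · simpa using hu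
  · simpa [h] using hx j trivial

variable {ι : Type*} {V : ι → Type*} [∀ i, NormedAddCommGroup (V i)] [∀ i, NormedSpace ℝ (V i)]
  {X : ∀ i, Set (V i)}

theorem exists_seminorm_sub_le [Fintype ι] [∀ i, FiniteDimensional ℝ (V i)]
    (hX : ∀ i, IsCompact (X i)) (p : Seminorm ℝ (∀ i, V i)) :
    ∃ R, 0 ≤ R ∧ ∀ x ∈ jointSpace X, ∀ y ∈ jointSpace X, p (x - y) ≤ R := by
  have hp : Continuous p :=
    continuousOn_univ.1 (p.convexOn.continuousOn isOpen_univ)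
  have hS : IsCompact (jointSpace X) := isCompact_univ_pi hX
  obtain ⟨R, hR⟩ := (hS.prod hS).bddAbove_image
    (f := fun q : (∀ i, V i) × (∀ i, V i) => p (q.1 - q.2)) (by fun_prop)
  refine ⟨max R 0, le_max_right _ _, fun x hx y hy => le_max_of_le_left (hR ?_)⟩
  exact ⟨(x, y), ⟨hx, hy⟩, rfl⟩

/-- On feasible directions a partial gradient is a component of the gradient of the potential. -/
theorem IsPartialGradient.eq_gradient_potential [Fintype ι] [DecidableEq ι]
    (hX : ∀ i, Convex ℝ (X i)) {J : ι → (∀ i, V i) → ℝ} {G : ∀ i, (∀ j, V j) → StrongDual ℝ (V i)}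
    (hG : IsPartialGradient X J G) {Φ : (∀ i, V i) → ℝ} (hpot : IsPotential X J Φ)
    {f' : StrongDual ℝ (∀ i, V i)} {x : ∀ i, V i} (hx : x ∈ jointSpace X)
    (hf' : HasFDerivWithinAt Φ f' (jointSpace X) x) {i : ι} {u v : V i} (hu : u ∈ X i)
    (hv : v ∈ X i) : G i x (u - v) = f' (Pi.single i (u - v)) := by
  have hxi : x i ∈ X i := hx i trivial
  have key : ∀ u ∈ X i, G i x (u - x i) = f' (Pi.single i (u - x i)) := by
    intro u hu
    have h1 := (hG i x hx).hasDerivWithinAt_segment (hX i) hxi hu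
    have h2 := hf'.hasDerivWithinAt_segment (convex_pi fun i _ => hX i) hx
      (update_mem_jointSpace hx hu)
    have hdir : Function.update x i u - x = Pi.single i (u - x i) := by
      ext j
      rcases eq_or_ne j i with rfl | h
      · simp
      · simp [h]
    have hline : ∀ t : ℝ, x + t • (Function.update x i u - x) =
        Function.update x i (x i + t • (u - x i)) := by
      intro t
      ext j
      rcases eq_or_ne j i with rfl | h
      · simp
      · simp [h]
    rw [hdir] at h2
    have h3 : HasDerivWithinAt (fun t : ℝ => J i (Function.update x i (x i + t • (u - x i))))
        (f' (Pi.single i (u - x i))) (Set.Icc 0 1) 0 := by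
      -- Along this segment `J i` and `Φ` differ by a constant.
      refine (h2.add_const (J i x - Φ x)).congr (fun t ht => ?_) ?_
      · have := hpot i x hx _ ((hX i).add_smul_sub_mem hxi hu ht)
        rw [← hdir, hline]
        linarith
      · simp
    exact (uniqueDiffOn_Icc zero_lt_one 0 (by simp)).eq_deriv _ h1 h3
  -- Gradients are determined only along feasible directions from `x i`; linearity extends the
  -- identity to their differences.
  have : u - v = (u - x i) - (v - x i) := by abel
  rw [this, (G i x).map_sub (u - x i), Pi.single_sub, f'.map_sub, key u hu, key v hv]

end Game

/-! ### Movement of the averaged iterates -/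

section AveragingScheme

/-- Both sequences are running averages with weights `a₀ / k`, which differ in the most recent
point only. -/
structure IsAveragingScheme {E : Type*} [AddCommGroup E] [Module ℝ E] (S : Set E) (a₀ : ℝ)
    (x y v w : ℕ → E) : Prop where
  v_mem : ∀ k, v k ∈ S
  w_mem : ∀ k, w k ∈ S
  y_succ : ∀ k : ℕ, y (k + 1) =
    (stepSum (fun k : ℕ => a₀ / k) k / stepSum (fun k : ℕ => a₀ / k) (k + 1)) • y k +
    (a₀ / ((k + 1 : ℕ) : ℝ) / stepSum (fun k : ℕ => a₀ / k) (k + 1)) • v (k + 1)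
  x_succ : ∀ k : ℕ, x (k + 1) =
    (stepSum (fun k : ℕ => a₀ / k) k / stepSum (fun k : ℕ => a₀ / k) (k + 1)) • y k +
    (a₀ / ((k + 1 : ℕ) : ℝ) / stepSum (fun k : ℕ => a₀ / k) (k + 1)) • w k

namespace IsAveragingScheme

variable {E : Type*} [AddCommGroup E] [Module ℝ E] {S : Set E} {a₀ : ℝ} {x y v w : ℕ → E}
  {p : Seminorm ℝ E} {R : ℝ}

theorem weights_add (ha₀ : 0 < a₀) (k : ℕ) :
    stepSum (fun k : ℕ => a₀ / k) k / stepSum (fun k : ℕ => a₀ / k) (k + 1) +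
      a₀ / ((k + 1 : ℕ) : ℝ) / stepSum (fun k : ℕ => a₀ / k) (k + 1) = 1 := by
  have := ha₀.trans_le (le_stepSum_const_div ha₀ (Nat.le_add_left 1 k))
  rw [← add_div, div_eq_one_iff_eq this.ne', stepSum_succ]

theorem average_mem (hS : Convex ℝ S) (ha₀ : 0 < a₀) {k : ℕ} {y u : E} (hy : k = 0 ∨ y ∈ S)
    (hu : u ∈ S) :
    (stepSum (fun k : ℕ => a₀ / k) k / stepSum (fun k : ℕ => a₀ / k) (k + 1)) • y +
      (a₀ / ((k + 1 : ℕ) : ℝ) / stepSum (fun k : ℕ => a₀ / k) (k + 1)) • u ∈ S := by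
  have hw := weights_add ha₀ k
  have hpos := ha₀.trans_le (le_stepSum_const_div ha₀ (Nat.le_add_left 1 k))
  rcases hy with rfl | hy
  · rw [stepSum_zero, zero_div, zero_add] at hw
    rw [hw, stepSum_zero, zero_div, zero_smul, zero_add, one_smul]
    exact hu
  · have h0 : 0 ≤ stepSum (fun k : ℕ => a₀ / k) k := by
      simpa using stepSum_const_div_mono ha₀ (Nat.zero_le k)
    exact hS hy hu (by positivity) (by positivity) hw

theorem y_mem (h : IsAveragingScheme S a₀ x y v w) (hS : Convex ℝ S) (ha₀ : 0 < a₀) (k : ℕ) :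
    y (k + 1) ∈ S := by
  induction k with
  | zero => rw [h.y_succ]; exact average_mem hS ha₀ (Or.inl rfl) (h.v_mem _)
  | succ k ih => rw [h.y_succ]; exact average_mem hS ha₀ (Or.inr ih) (h.v_mem _)

theorem eq_zero_or_y_mem (h : IsAveragingScheme S a₀ x y v w) (hS : Convex ℝ S) (ha₀ : 0 < a₀)
    (k : ℕ) : k = 0 ∨ y k ∈ S := by
  cases k with
  | zero => exact Or.inl rfl
  | succ k => exact Or.inr (h.y_mem hS ha₀ k)

theorem x_mem (h : IsAveragingScheme S a₀ x y v w) (hS : Convex ℝ S) (ha₀ : 0 < a₀) (k : ℕ) :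
    x (k + 1) ∈ S := by
  rw [h.x_succ]
  exact average_mem hS ha₀ (h.eq_zero_or_y_mem hS ha₀ k) (h.w_mem _)

theorem seminorm_y_sub_x_le (h : IsAveragingScheme S a₀ x y v w) (ha₀ : 0 < a₀)
    (hR : ∀ x ∈ S, ∀ y ∈ S, p (x - y) ≤ R) (k : ℕ) :
    p (y (k + 1) - x (k + 1)) ≤
      a₀ / ((k + 1 : ℕ) : ℝ) / stepSum (fun k : ℕ => a₀ / k) (k + 1) * R := by
  have hpos := ha₀.trans_le (le_stepSum_const_div ha₀ (Nat.le_add_left 1 k))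
  have hr : 0 ≤ a₀ / ((k + 1 : ℕ) : ℝ) / stepSum (fun k : ℕ => a₀ / k) (k + 1) := by positivity
  rw [h.y_succ, h.x_succ, add_sub_add_left_eq_sub, ← smul_sub, map_smul_eq_mul,
    Real.norm_of_nonneg hr]
  exact mul_le_mul_of_nonneg_left (hR _ (h.v_mem _) _ (h.w_mem _)) hr

/-- Pass through `y (k + 1)`: it differs from either iterate by a step weight times a difference of
points of `S`, and these weights decrease. -/
theorem seminorm_x_succ_sub_x_le (h : IsAveragingScheme S a₀ x y v w) (hS : Convex ℝ S)
    (ha₀ : 0 < a₀) (hR0 : 0 ≤ R) (hR : ∀ x ∈ S, ∀ y ∈ S, p (x - y) ≤ R) (k : ℕ) :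
    p (x (k + 2) - x (k + 1)) ≤
      2 * R * (a₀ / ((k + 1 : ℕ) : ℝ) / stepSum (fun k : ℕ => a₀ / k) (k + 1)) := by
  have hpos := ha₀.trans_le (le_stepSum_const_div ha₀ (Nat.le_add_left 1 k))
  have hpos' := ha₀.trans_le (le_stepSum_const_div ha₀ (Nat.le_add_left 1 (k + 1)))
  have hmono := stepSum_const_div_mono ha₀ (Nat.le_succ (k + 1))
  have hr' : 0 ≤ a₀ / ((k + 1 + 1 : ℕ) : ℝ) / stepSum (fun k : ℕ => a₀ / k) (k + 1 + 1) := by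
    positivity
  have hle : a₀ / ((k + 1 + 1 : ℕ) : ℝ) / stepSum (fun k : ℕ => a₀ / k) (k + 1 + 1) ≤
      a₀ / ((k + 1 : ℕ) : ℝ) / stepSum (fun k : ℕ => a₀ / k) (k + 1) := by
    refine div_le_div₀ (by positivity) ?_ hpos hmono
    exact div_le_div_of_nonneg_left ha₀.le (by positivity) (by push_cast; linarith)
  have h1 : x (k + 2) - y (k + 1) =
      (a₀ / ((k + 1 + 1 : ℕ) : ℝ) / stepSum (fun k : ℕ => a₀ / k) (k + 1 + 1)) •
        (w (k + 1) - y (k + 1)) := by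
    rw [h.x_succ (k + 1), eq_sub_of_add_eq (weights_add ha₀ (k + 1)), sub_smul, one_smul, smul_sub]
    abel
  have h2 : p (x (k + 2) - y (k + 1)) ≤
      a₀ / ((k + 1 : ℕ) : ℝ) / stepSum (fun k : ℕ => a₀ / k) (k + 1) * R := by
    rw [h1, map_smul_eq_mul, Real.norm_of_nonneg hr']
    refine (mul_le_mul_of_nonneg_left (hR _ (h.w_mem _) _ (h.y_mem hS ha₀ k)) hr').trans ?_
    exact mul_le_mul_of_nonneg_right hle hR0
  have h3 := map_add_le_add p (x (k + 2) - y (k + 1)) (y (k + 1) - x (k + 1))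
  rw [sub_add_sub_cancel] at h3
  linarith [h.seminorm_y_sub_x_le ha₀ hR k]

theorem seminorm_x_sub_x_le (h : IsAveragingScheme S a₀ x y v w) (hS : Convex ℝ S)
    (ha₀ : 0 < a₀) (hR0 : 0 ≤ R) (hR : ∀ x ∈ S, ∀ y ∈ S, p (x - y) ≤ R) {s : ℕ} (hs : 1 ≤ s)
    (m : ℕ) :
    p (x (s + m) - x s) ≤ 2 * R / stepSum (fun k : ℕ => a₀ / k) s * (m * (a₀ / s)) := by
  have hs' : (0 : ℝ) < s := by exact_mod_cast hs
  have hpos := ha₀.trans_le (le_stepSum_const_div ha₀ hs)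
  induction m with
  | zero => simp
  | succ m ih =>
    have h1 : p (x (s + (m + 1)) - x (s + m)) ≤
        2 * R / stepSum (fun k : ℕ => a₀ / k) s * (a₀ / s) := by
      obtain ⟨j, hj⟩ : ∃ j, s + m = j + 1 := ⟨s + m - 1, by omega⟩
      have hsj : s ≤ j + 1 := by omega
      have h2 := h.seminorm_x_succ_sub_x_le hS ha₀ hR0 hR j
      rw [show s + (m + 1) = j + 2 by omega, hj]
      refine h2.trans ?_
      rw [div_mul_eq_mul_div, ← mul_div_assoc]
      have : (s : ℝ) ≤ ((j + 1 : ℕ) : ℝ) := by exact_mod_cast hsj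
      have hA := stepSum_const_div_mono ha₀ hsj
      refine div_le_div₀ (by positivity) ?_ hpos hA
      gcongr
    have h3 := map_add_le_add p (x (s + (m + 1)) - x (s + m)) (x (s + m) - x s)
    rw [sub_add_sub_cancel] at h3
    push_cast
    linarith

/-- Iterates at proportional times are close. -/
theorem seminorm_x_sub_x_le_of_le_mul (h : IsAveragingScheme S a₀ x y v w) (hS : Convex ℝ S)
    (ha₀ : 0 < a₀) (hR0 : 0 ≤ R) (hR : ∀ x ∈ S, ∀ y ∈ S, p (x - y) ≤ R) {c : ℝ} {s k : ℕ}
    (hs : 1 ≤ s) (hsk : s ≤ k) (hc : (k : ℝ) ≤ c * s) :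
    p (x k - x s) ≤ 2 * R * c * a₀ * (1 + c) / stepSum (fun k : ℕ => a₀ / k) k := by
  have hs' : (0 : ℝ) < s := by exact_mod_cast hs
  have hk' : (s : ℝ) ≤ k := by exact_mod_cast hsk
  have hc0 : 0 < c := by by_contra! h; nlinarith
  have hA := stepSum_const_div_le_mul ha₀ hs hsk hc
  have hpos := ha₀.trans_le (le_stepSum_const_div ha₀ hs)
  have hpos' := ha₀.trans_le (le_stepSum_const_div ha₀ (hs.trans hsk))
  obtain ⟨m, rfl⟩ := Nat.exists_eq_add_of_le hsk
  refine (h.seminorm_x_sub_x_le hS ha₀ hR0 hR hs m).trans ?_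
  have h3 : (m : ℝ) * (a₀ / s) ≤ c * a₀ := by
    rw [mul_div_assoc', div_le_iff₀ hs']
    push_cast at hc
    nlinarith
  calc _ ≤ 2 * R / stepSum (fun k : ℕ => a₀ / k) s * (c * a₀) := by gcongr
    _ ≤ _ := by
      rw [div_mul_eq_mul_div, div_le_div_iff₀ hpos hpos']
      have : 0 ≤ 2 * R * (c * a₀) := by positivity
      nlinarith

end IsAveragingScheme

end AveragingScheme

/-! ### Delayed feedback and the convergence rate -/

section Game

variable {ι : Type*} {V : ι → Type*}
  [∀ i, NormedAddCommGroup (V i)] [∀ i, NormedSpace ℝ (V i)] {X : ∀ i, Set (V i)}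

theorem IsDelayedRun.isAveragingScheme {ψ : ∀ i, V i → ℝ}
    {G : ∀ i, (∀ j, V j) → StrongDual ℝ (V i)} {a₀ : ℝ} (ha₀ : 0 < a₀) {d : ι → ℕ → ℝ}
    {x y : ℕ → ∀ i, V i} {z : ℕ → ∀ i, StrongDual ℝ (V i)}
    (h : IsDelayedRun X ψ G (fun k => a₀ / k) d x y z) (hX : ∀ i, IsCompact (X i))
    (hne : ∀ i, (X i).Nonempty) (hψ : ∀ i, ContinuousOn (ψ i) (X i)) :
    IsAveragingScheme (jointSpace X) a₀ x y (fun k i => mirrorMap (X i) (ψ i) (z k i))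
      (fun k => if k = 0 then x 0 else fun i => mirrorMap (X i) (ψ i) (z k i)) := by
  have hv : ∀ k, (fun i => mirrorMap (X i) (ψ i) (z k i)) ∈ jointSpace X :=
    fun k i _ => (mirrorMap_spec (hX i) (hne i) (hψ i) _).1
  refine ⟨hv, fun k => ?_, fun k => funext (h.y_step k), fun k => ?_⟩
  · split_ifs
    · exact h.x_zero_mem
    · exact hv k
  · cases k with
    | zero =>
      -- At the first stage the old average has weight zero, so taking `x 0` as the new point
      -- reproduces `x 1 = x 0`.
      have hw := IsAveragingScheme.weights_add ha₀ 0
      rw [stepSum_zero, zero_div, zero_add] at hw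
      rw [hw, stepSum_zero, zero_div, zero_smul, one_smul, if_pos rfl]
      exact h.x_one.trans (zero_add _).symm
    | succ k =>
      rw [if_neg (Nat.succ_ne_zero k)]
      exact funext (h.x_step k)

/-- Error made by replacing the gradient of the potential by delayed partial gradients. -/
theorem IsPartialGradient.gradient_potential_sub_le [Fintype ι] [DecidableEq ι]
    (hX : ∀ i, Convex ℝ (X i))
    {J : ι → (∀ i, V i) → ℝ} {G : ∀ i, (∀ j, V j) → StrongDual ℝ (V i)}
    (hG : IsPartialGradient X J G) {Φ : (∀ i, V i) → ℝ} (hpot : IsPotential X J Φ)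
    {f' : (∀ i, V i) → StrongDual ℝ (∀ i, V i)} {p : Seminorm ℝ (∀ i, V i)} {M R δ : ℝ}
    (hf' : ∀ x ∈ jointSpace X, HasFDerivWithinAt Φ (f' x) (jointSpace X) x)
    (hM : 0 ≤ M)
    (hL : ∀ x ∈ jointSpace X, ∀ y ∈ jointSpace X, ∀ w, |(f' x - f' y) w| ≤ M * p (x - y) * p w)
    (hR : ∀ x ∈ jointSpace X, ∀ y ∈ jointSpace X, p (x - y) ≤ R)
    {x v u : ∀ i, V i} {xs : ι → ∀ i, V i} (hx : x ∈ jointSpace X) (hv : v ∈ jointSpace X)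
    (hu : u ∈ jointSpace X) (hxs : ∀ i, xs i ∈ jointSpace X) (hδ0 : 0 ≤ δ)
    (hδ : ∀ i, p (x - xs i) ≤ δ) :
    f' x (v - u) ≤ ∑ i, G i (xs i) (v i - u i) + Fintype.card ι * (M * δ * R) := by
  have hterm : ∀ i, f' x (Pi.single i (v i - u i)) ≤ G i (xs i) (v i - u i) + M * δ * R := by
    intro i
    rw [hG.eq_gradient_potential hX hpot (hxs i) (hf' _ (hxs i)) (hv i trivial) (hu i trivial)]
    have h1 := (le_abs_self _).trans (hL x hx (xs i) (hxs i) (Pi.single i (v i - u i)))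
    have h2 : p (Pi.single i (v i - u i)) ≤ R := by
      -- A one-player deviation is a difference of two feasible profiles, so the diameter bound
      -- applies.
      have : Pi.single i (v i - u i) = Function.update u i (v i) - u := by
        ext j
        rcases eq_or_ne j i with rfl | h
        · simp
        · simp [h]
      rw [this]
      exact hR _ (update_mem_jointSpace hu (hv i trivial)) _ hu
    have h3 : M * p (x - xs i) * p (Pi.single i (v i - u i)) ≤ M * δ * R := by
      have := hδ i
      gcongr
    rw [sub_apply] at h1
    linarith
  calc f' x (v - u) = ∑ i, f' x (Pi.single i (v i - u i)) := by
        rw [← map_sum]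
        congr 1
        exact (Finset.univ_sum_single (v - u)).symm
    _ ≤ ∑ i, (G i (xs i) (v i - u i) + M * δ * R) := Finset.sum_le_sum fun i _ => hterm i
    _ = _ := by simp [Finset.sum_add_distrib]

end Game

theorem corollary1 {N : ℕ} {V : Fin N → Type*}
    [∀ i, NormedAddCommGroup (V i)] [∀ i, NormedSpace ℝ (V i)] [∀ i, FiniteDimensional ℝ (V i)]
    -- strategy spaces: nonempty, closed, convex, bounded
    (X : ∀ i, Set (V i)) (hXne : ∀ i, (X i).Nonempty) (hXcl : ∀ i, IsClosed (X i))
    (hXcv : ∀ i, Convex ℝ (X i)) (hXbd : ∀ i, Bornology.IsBounded (X i))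
    -- objectives, with partial gradients on the strategy space
    (J : Fin N → (∀ i, V i) → ℝ) (G : ∀ i, (∀ j, V j) → StrongDual ℝ (V i))
    (hG : IsPartialGradient X J G)
    -- a convex potential that is `L`-smooth with respect to a norm `p` on the joint space
    (Φ : (∀ i, V i) → ℝ) (hpot : IsPotential X J Φ) (hcv : ConvexOn ℝ (jointSpace X) Φ)
    (p : Seminorm ℝ (∀ i, V i)) (hp : ∀ w, p w = 0 → w = 0)
    (L : ℝ) (hsm : IsSmoothOn p L (jointSpace X) Φ)
    -- strongly convex regularizers
    (ψ : ∀ i, V i → ℝ) (μ : Fin N → ℝ) (hμ : ∀ i, 0 < μ i)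
    (hψc : ∀ i, ContinuousOn (ψ i) (X i)) (hψ : ∀ i, StrongConvexOn (X i) (μ i) (ψ i))
    -- linearly bounded delays
    (d : Fin N → ℕ → ℝ) (D : ℝ) (hD : 0 < D)
    (hd : ∀ i, ∀ k : ℕ, 1 ≤ k → 0 ≤ d i k ∧ d i k ≤ D * k)
    -- a run of the algorithm with step sizes `a₀ / k`
    (a₀ : ℝ) (ha₀ : 0 < a₀)
    (x y : ℕ → ∀ i, V i) (z : ℕ → ∀ i, StrongDual ℝ (V i))
    (hrun : IsDelayedRun X ψ G (fun k => a₀ / k) d x y z)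
    -- a minimizer of the potential
    (xmin : ∀ i, V i) (hmem : xmin ∈ jointSpace X) (hmin : IsMinOn Φ (jointSpace X) xmin) :
    (fun k : ℕ => Φ (y k) - Φ xmin) =O[atTop]
      (fun k : ℕ => Real.log (Real.log k) / Real.log k) := by
  obtain ⟨f', hf', hLip⟩ := hsm
  have hXc : ∀ i, IsCompact (X i) := fun i =>
    Metric.isCompact_of_isClosed_isBounded (hXcl i) (hXbd i)
  obtain ⟨R, hR0, hR⟩ := exists_seminorm_sub_le hXc p
  have hS : Convex ℝ (jointSpace X) := hcv.1
  have hM : ∀ x ∈ jointSpace X, ∀ y ∈ jointSpace X, ∀ w,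
      |(f' x - f' y) w| ≤ |L| * p (x - y) * p w := fun x hx y hy w =>
    (hLip x hx y hy w).trans (by gcongr; exact le_abs_self L)
  have hav := hrun.isAveragingScheme ha₀ hXc hXne hψc
  have hxm := hav.x_mem hS ha₀
  have hym := hav.y_mem hS ha₀
  set A := stepSum (fun k : ℕ => a₀ / k) with hAdef
  set v : ℕ → ∀ i, V i := fun k i => mirrorMap (X i) (ψ i) (z k i) with hvdef
  have hApos : ∀ k, 0 < A (k + 1) := fun k =>
    ha₀.trans_le (le_stepSum_const_div ha₀ (Nat.le_add_left 1 k))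
  -- `c` bounds the ratio of the iteration to the stage in use, and `C / A k` the resulting distance
  -- of iterates; `K` collects the delay errors of the `N` players and the smoothness error.
  set c := 2 * (1 + D) with hc
  set C := 2 * R * c * a₀ * (1 + c) with hC
  have hC0 : 0 ≤ C := by positivity
  set K := N * (|L| * C * R) + a₀ * (|L| * R ^ 2) with hK
  let B : Fin N → ℝ := fun i => (ψ i (xmin i) - z 0 i (xmin i)) -
    (ψ i (v 0 i) - z 0 i (v 0 i))
  have hstep : ∀ k, A (k + 1) * (Φ (y (k + 1)) - Φ xmin) - A k * (Φ (y k) - Φ xmin) ≤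
      ∑ i, a₀ / ((k + 1 : ℕ) : ℝ) * G i (x (usedStage (d i) (k + 1))) (v (k + 1) i - xmin i) +
        K * (a₀ / ((k + 1 : ℕ) : ℝ) / A (k + 1)) := by
    intro k
    have ha : 0 < a₀ / ((k + 1 : ℕ) : ℝ) := by positivity
    have hA0 : 0 ≤ A k := by simpa using stepSum_const_div_mono ha₀ (Nat.zero_le k)
    have hsucc : A (k + 1) = A k + a₀ / ((k + 1 : ℕ) : ℝ) := stepSum_succ _ k
    have h1 := hcv.averaging_step (u := xmin) (y₀ := y k) (v := v (k + 1)) hf' hM (hxm k) (hym k)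
      hmem hA0 ha.le
      ((hav.eq_zero_or_y_mem hS ha₀ k).imp (fun h => by rw [h]; exact stepSum_zero _) id) hsucc
      (by
        rw [hav.y_succ k, smul_add, smul_smul, smul_smul, mul_div_cancel₀ _ (hApos k).ne',
          mul_div_cancel₀ _ (hApos k).ne'])
    have h2 := hG.gradient_potential_sub_le hXcv hpot hf' (abs_nonneg L) hM hR
      (xs := fun i => x (usedStage (d i) (k + 1))) (δ := C / A (k + 1)) (hxm k)
      (hav.v_mem (k + 1)) hmem
      (fun i => by
        obtain ⟨j, hj⟩ : ∃ j, usedStage (d i) (k + 1) = j + 1 :=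
          ⟨usedStage (d i) (k + 1) - 1, by have := one_le_usedStage (d i) (k + 1); omega⟩
        rw [hj]
        exact hxm j)
      (div_nonneg hC0 (hApos k).le)
      (fun i => hav.seminorm_x_sub_x_le_of_le_mul hS ha₀ hR0 hR (one_le_usedStage _ _)
        (usedStage_le _ (Nat.le_add_left 1 k)) (le_mul_usedStage hD (hd i) (k + 1)))
    -- Of the two factors `a₀ / (k + 1)` in the squared distance, one is bounded by `a₀`.
    have h3 : A (k + 1) * (|L| * p (y (k + 1) - x (k + 1)) ^ 2) ≤
        a₀ * (|L| * R ^ 2) * (a₀ / ((k + 1 : ℕ) : ℝ) / A (k + 1)) := by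
      have h4 := hav.seminorm_y_sub_x_le ha₀ hR k
      have h5 : a₀ / ((k + 1 : ℕ) : ℝ) ≤ a₀ :=
        div_le_self ha₀.le (by push_cast; linarith [k.cast_nonneg (α := ℝ)])
      calc A (k + 1) * (|L| * p (y (k + 1) - x (k + 1)) ^ 2)
          ≤ A (k + 1) * (|L| * (a₀ / ((k + 1 : ℕ) : ℝ) / A (k + 1) * R) ^ 2) := by
            have := (hApos k).le
            gcongr
        _ = a₀ / ((k + 1 : ℕ) : ℝ) * (|L| * R ^ 2) * (a₀ / ((k + 1 : ℕ) : ℝ) / A (k + 1)) := by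
            have := (hApos k).ne'
            field_simp
        _ ≤ _ := by
            have := (hApos k).le
            gcongr
    have h6 := mul_le_mul_of_nonneg_left h2 ha.le
    rw [mul_add, Finset.mul_sum, Fintype.card_fin] at h6
    have h7 : a₀ / ((k + 1 : ℕ) : ℝ) * (N * (|L| * (C / A (k + 1)) * R)) =
        N * (|L| * C * R) * (a₀ / ((k + 1 : ℕ) : ℝ) / A (k + 1)) := by ring
    rw [h7] at h6
    have h8 : A (k + 1) * Φ xmin - A k * Φ xmin = a₀ / ((k + 1 : ℕ) : ℝ) * Φ xmin := by
      rw [hsucc]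
      ring
    rw [hK, add_mul]
    linarith
  refine isBigO_loglog_div_log ha₀ (K₀ := ∑ i, B i) (K := K) (by positivity) (fun n hn => ?_)
    fun n => ?_
  · obtain ⟨m, rfl⟩ : ∃ m, n = m + 1 := ⟨n - 1, by omega⟩
    exact sub_nonneg.2 (hmin (hym m))
  -- The weighted gaps telescope from `A 0 = 0`, so the value at `y 0` is irrelevant; exchanging the
  -- sums leaves one regret per player.
  · have htel := Finset.sum_range_sub (fun k => A k * (Φ (y k) - Φ xmin)) (n + 1)
    have hA0 : A 0 = 0 := stepSum_zero _
    rw [hA0, zero_mul, sub_zero] at htel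
    rw [← htel, Finset.mul_sum]
    refine (Finset.sum_le_sum fun k _ => hstep k).trans ?_
    rw [Finset.sum_add_distrib, Finset.sum_comm]
    refine add_le_add_left (Finset.sum_le_sum fun i _ => ?_) _
    exact mirrorMap_regret (hXc i) (hXne i) (hψc i) (z := fun k => z k i)
      (g := fun k => G i (x (usedStage (d i) k))) (a := fun k => a₀ / k)
      (fun k => hrun.z_step k i) (hmem i trivial) (n + 1)
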